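/- Let $X$ and $Z$ be finite metric spaces and let $f_\bullet\colon X\to Z$ be an injective set map (not necessarily non-expansive). Notation. For a finite metric space $Y$ and $r\ge 0$, let $\mathrm{VR}_r(Y)$ be the graph on $Y$ in which two distinct points are joined by an edge when their distance is at most $r$, let $H_0(\mathrm{VR}_r(Y))$ be the free $\mathbb{Z}_2$-vector space on its connected components, and let $\mathrm{PH}_0(Y)$ be the persistence module formed by these spaces with the linear maps $\rho_{rs}$, $r\le s$, induced by inclusion. There is an isomorphism $\mathrm{PH}_0(Y)\simeq\bigoplus_{b>0}\kappa_b^{\,m(b)}\oplus\kappa_\infty$ for $Y\neq\emptyset$ (and $\mathrm{PH}_0(\emptyset)=0$), where $\kappa_b$ is the interval module of $[0,b)$ over $\mathbb{Z}_2$; the barcode $B(\mathrm{PH}_0(Y))$ is the finite multiset in which each $b>0$ has multiplicity $m(b)$, and its representation is the set $\mathrm{Rep}\,B(\mathrm{PH}_0(Y))=\{(b,\ell) : b>0,\ 1\le \ell\le m(b)\}$. For $b>0$ put $\ker_b^+(\mathrm{PH}_0(Y))=\ker\rho_{0b}$ and $\ker_b^-(\mathrm{PH}_0(Y))=\bigcup_{0\le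 r<b}\ker\rho_{0r}$, which are subspaces of $H_0(\mathrm{VR}_0(Y))=\langle Y\rangle$. Let $V=\mathrm{PH}_0(X)$, $U=\mathrm{PH}_0(Z)$, let $f_0\colon H_0(\mathrm{VR}_0(X))\to H_0(\mathrm{VR}_0(Z))$ be the linear map induced by $f_\bullet$, and for $a,b>0$ let $$\mathcal{M}^0_f(a,b)=\dim\frac{f_0(\ker_a^+(V))\cap\ker_b^+(U)}{f_0(\ker_a^-(V))\cap\ker_b^+(U)+f_0(\ker_a^+(V))\cap\ker_b^-(U)}.$$ Then the block function $\mathcal{M}^0_f$ induces an injection $\sigma^f\colon \mathrm{Rep}\,B(V)\hookrightarrow\mathrm{Rep}\,B(U)$; that is, there is an injective map $\sigma^f$ defined on all of $\mathrm{Rep}\,B(V)$ such that for all $a,b>0$ exactly $\mathcal{M}^0_f(a,b)$ of the elements $(a,i)\in\mathrm{Rep}\,B(V)$ are sent by $\sigma^f$ to an element of the form $(b,j)$. -/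

import Mathlib

open scoped NNReal ENNReal DirectSum

/-- A persistence module over the field `ℤ/2`, indexed by the filtration values `r ∈ [0,∞)`. -/
structure PersistenceModule where
  obj : ℝ≥0 → Type*
  [addCommGroup : ∀ r, AddCommGroup (obj r)]
  [module : ∀ r, Module (ZMod 2) (obj r)]
  map : ∀ {s t : ℝ≥0}, s ≤ t → obj s →ₗ[ZMod 2] obj t
  map_id : ∀ r : ℝ≥0, map (le_refl r) = LinearMap.id
  map_comp : ∀ {r s t : ℝ≥0} (hrs : r ≤ s) (hst : s ≤ t),
    map hst ∘ₗ map hrs = map (hrs.trans hst)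

namespace PersistenceModule

attribute [instance] PersistenceModule.addCommGroup PersistenceModule.module

/-- Two persistence modules are isomorphic: there are linear isomorphisms in every degree that
commute with the structure maps. -/
def IsIsomorphic (V W : PersistenceModule) : Prop :=
  ∃ e : ∀ r, V.obj r ≃ₗ[ZMod 2] W.obj r,
    ∀ {s t : ℝ≥0} (h : s ≤ t) (x : V.obj s), e t (V.map h x) = W.map h (e s x)

/-- The interval module `κ_b` of the interval `[0,b)`, where `b = ∞` is allowed. Its value at `t`
is the space of functions to `ℤ/2` on a set that has one point if `t < b` and is empty otherwise:
a copy of `ℤ/2` for `t < b`, and zero for `b ≤ t`. The structure maps restrict functions: they are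
the identity as long as the target is nonzero. -/
def interval (b : ℝ≥0∞) : PersistenceModule where
  obj t := PLift ((t : ℝ≥0∞) < b) → ZMod 2
  map h := LinearMap.funLeft (ZMod 2) (ZMod 2)
    (fun p => ⟨lt_of_le_of_lt (ENNReal.coe_le_coe.2 h) p.down⟩)
  map_id _ := rfl
  map_comp _ _ := rfl

/-- The direct sum of a family of persistence modules, taken degreewise. -/
noncomputable def directSum {ι : Type*} (V : ι → PersistenceModule) : PersistenceModule where
  obj t := ⨁ i, (V i).obj t
  map h := DirectSum.lmap fun i => (V i).map h
  map_id r := by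
    simp only [map_id]
    exact DirectSum.lmap_id
  map_comp hrs hst := by
    rw [← DirectSum.lmap_comp]
    simp only [map_comp]

/-- The finite multiset `B` of endpoints `b > 0` is the barcode of `U`: the persistence module `U`
is isomorphic to the direct sum of the modules `κ_b`, one for every element `(b, ℓ)` of the
representation `Rep B = {(b, ℓ) | ℓ < multiplicity of b}`, and of copies of `κ_∞`. The infinite
intervals are not recorded in the barcode. (For the persistent homology in dimension zero of a
nonempty finite metric space there is exactly one copy of `κ_∞`, for the empty one there is none.)

`Rep B` is the type `↥B` that Mathlib attaches to the multiset `B`. -/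
def IsBarcode (U : PersistenceModule) (B : Multiset ℝ≥0) : Prop :=
  (∀ b ∈ B, 0 < b) ∧
    ∃ k : ℕ, U.IsIsomorphic
      (directSum (Sum.elim (fun p : B => interval (p.1 : ℝ≥0∞)) (fun _ : Fin k => interval ⊤)))

open Classical in
/-- The barcode of a persistence module that has a (necessarily unique) finite barcode
in the sense of `IsBarcode`. -/
noncomputable def barcode (U : PersistenceModule) : Multiset ℝ≥0 :=
  if h : ∃ B, U.IsBarcode B then h.choose else 0

/-- `ker⁺_b(U)`: the classes in degree `0` that die at some value `≤ b`. -/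
def kerPlus (U : PersistenceModule) (b : ℝ≥0) : Submodule (ZMod 2) (U.obj 0) :=
  LinearMap.ker (U.map (zero_le : 0 ≤ b))

/-- `ker⁻_b(U)`: the union over `0 ≤ r < b` of the kernels of the structure maps `U_0 → U_r`.
The kernels increase with `r`, so the supremum is the union (see `mem_kerMinus`). -/
def kerMinus (U : PersistenceModule) (b : ℝ≥0) : Submodule (ZMod 2) (U.obj 0) :=
  ⨆ r : {r : ℝ≥0 // r < b}, LinearMap.ker (U.map (zero_le : 0 ≤ r.1))

theorem mem_kerMinus (U : PersistenceModule) {b : ℝ≥0} (hb : 0 < b) (x : U.obj 0) :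
    x ∈ U.kerMinus b ↔ ∃ r < b, U.map (zero_le : 0 ≤ r) x = 0 := by
  have : Nonempty {r : ℝ≥0 // r < b} := ⟨⟨0, hb⟩⟩
  have key : ∀ {r s : ℝ≥0}, r ≤ s →
      LinearMap.ker (U.map (zero_le : 0 ≤ r)) ≤ LinearMap.ker (U.map (zero_le : 0 ≤ s)) := by
    intro r s h y hy
    rw [LinearMap.mem_ker] at hy ⊢
    rw [← U.map_comp (zero_le : 0 ≤ r) h, LinearMap.comp_apply, hy, map_zero]
  rw [kerMinus, Submodule.mem_iSup_of_directed]
  · exact ⟨fun ⟨r, hr⟩ => ⟨r.1, r.2, hr⟩, fun ⟨r, h, hr⟩ => ⟨⟨r, h⟩, hr⟩⟩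
  · intro r s
    exact ⟨⟨max r.1 s.1, max_lt r.2 s.2⟩, key (le_max_left _ _), key (le_max_right _ _)⟩

end PersistenceModule

open PersistenceModule

/-- The graph `VR_r(Z)`, the 1-skeleton of the Vietoris–Rips complex of `Z` at the value `r`. -/
def vietorisRips (Z : Type*) [MetricSpace Z] (r : ℝ≥0) : SimpleGraph Z where
  Adj x y := x ≠ y ∧ dist x y ≤ r
  symm := ⟨fun x y h => ⟨h.1.symm, by rw [dist_comm]; exact h.2⟩⟩
  loopless := ⟨fun _ h => h.1 rfl⟩

theorem vietorisRips_mono (Z : Type*) [MetricSpace Z] {r s : ℝ≥0} (h : r ≤ s) :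
    vietorisRips Z r ≤ vietorisRips Z s :=
  fun _ _ hxy => ⟨hxy.1, hxy.2.trans (NNReal.coe_le_coe.2 h)⟩

/-- The homology in dimension zero of a graph: the free `ℤ/2`-vector space on the set of its
connected components. -/
abbrev graphH0 {Z : Type*} (G : SimpleGraph Z) : Type _ := G.ConnectedComponent →₀ ZMod 2

/-- The map in homology in dimension zero induced by a graph homomorphism. -/
noncomputable def graphH0Map {X Z : Type*} {G : SimpleGraph X} {H : SimpleGraph Z} (φ : G →g H) :
    graphH0 G →ₗ[ZMod 2] graphH0 H :=
  Finsupp.lmapDomain (ZMod 2) (ZMod 2) (SimpleGraph.ConnectedComponent.map φ)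

/-- The persistent homology in dimension zero, `PH_0(Z)`, of the filtered graph `VR(Z)`. -/
noncomputable def PH0 (Z : Type*) [MetricSpace Z] : PersistenceModule where
  obj r := graphH0 (vietorisRips Z r)
  map h := graphH0Map (SimpleGraph.Hom.ofLE (vietorisRips_mono Z h))
  map_id r := by
    have : SimpleGraph.ConnectedComponent.map
        (SimpleGraph.Hom.ofLE (vietorisRips_mono Z (le_refl r))) = id :=
      funext fun C => C.map_id
    rw [graphH0Map, this, Finsupp.lmapDomain_id]
  map_comp hrs hst := by
    rw [graphH0Map, graphH0Map, ← Finsupp.lmapDomain_comp, graphH0Map]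
    congr 1
    exact funext fun C => C.map_comp _ _

/-- A set map `f : X → Z`, as a homomorphism `VR_0(X) → VR_0(Z)`; the graph `VR_0(X)` has no edges
because `X` is a metric space. -/
def vietorisRipsZeroHom {X Z : Type*} [MetricSpace X] [MetricSpace Z] (f : X → Z) :
    vietorisRips X 0 →g vietorisRips Z 0 where
  toFun := f
  map_rel' h := absurd (dist_le_zero.1 h.2) h.1

/-- The linear map `f_0 : H_0(VR_0(X)) → H_0(VR_0(Z))` induced by a set map `f : X → Z`. -/
noncomputable def inducedZero {X Z : Type*} [MetricSpace X] [MetricSpace Z] (f : X → Z) :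
    (PH0 X).obj 0 →ₗ[ZMod 2] (PH0 Z).obj 0 :=
  graphH0Map (vietorisRipsZeroHom f)

/-- The block function `M⁰_f(a,b)`, for `a, b > 0`, of a set map `f : X → Z`: with
`A^± = f_0(ker^±_a(PH_0(X)))` and `B^± = ker^±_b(PH_0(Z))`, it is the dimension of
`(A⁺ ∩ B⁺) / (A⁻ ∩ B⁺ + A⁺ ∩ B⁻)`. -/
noncomputable def blockFunction {X Z : Type*} [MetricSpace X] [MetricSpace Z] (f : X → Z)
    (a b : ℝ≥0) : ℕ :=
  let Ap := ((PH0 X).kerPlus a).map (inducedZero f)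
  let Am := ((PH0 X).kerMinus a).map (inducedZero f)
  let Bp := (PH0 Z).kerPlus b
  let Bm := (PH0 Z).kerMinus b
  Module.finrank (ZMod 2) (↥(Ap ⊓ Bp) ⧸ (Am ⊓ Bp ⊔ Ap ⊓ Bm).submoduleOf (Ap ⊓ Bp))

/-- The map `σ : Rep B → Rep B'` is induced by the block function `M`: for all `a, b > 0`, exactly
`M(a,b)` of the copies `(a,i)` of `a` in `Rep B` are sent to a copy `(b,j)` of `b` in `Rep B'`. -/
def IsInducedBy {B B' : Multiset ℝ≥0} (σ : B → B') (M : ℝ≥0 → ℝ≥0 → ℕ) : Prop :=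
  ∀ a b : ℝ≥0, 0 < a → 0 < b → Nat.card {p : B // p.1 = a ∧ (σ p).1 = b} = M a b

/-! By `finrank_inf_quotient`, `M(a,b)` is the mixed second difference of `dim (f_0(A) ∩ C)` as `A`
passes from `ker⁻_a(V)` to `ker⁺_a(V)` and `C` from `ker⁻_b(U)` to `ker⁺_b(U)`. Its row and column
sums therefore telescope (`IsBarcode.sum_jumps`).

Rows: every element of `ker⁺_a(V)` has augmentation zero, so its image dies in `U` once the graph on
`Z` is connected (`exists_map_kerPlus_le`). Summing over `b` thus gives `dim f_0(ker⁺_a) - dim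
f_0(ker⁻_a)`, which is the multiplicity of `a`, because `f_0` is injective. Columns: summing over
`a` gives `dim (A ∩ ker⁺_b) - dim (A ∩ ker⁻_b)` for a single subspace `A`, and this is at most the
multiplicity of `b` (`finrank_inf_sub_le`).

A matrix with these row and column sums yields the injection by counting
(`exists_injective_isInducedBy`). Barcodes exist because the kernel filtration has an adapted basis
(`exists_basis_adapted`). -/

/-! ### Injections from matrices of natural numbers -/

theorem exists_injective_of_card_fiber_le {α β γ : Type*} [Finite α] [Finite β]
    (p : α → γ) (q : β → γ) (h : ∀ c, Nat.card {x // p x = c} ≤ Nat.card {y // q y = c}) :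
    ∃ g : α → β, Function.Injective g ∧ ∀ x, q (g x) = p x := by
  have key : ∀ c, ∃ g : {x // p x = c} → {y // q y = c}, Function.Injective g := by
    intro c
    have := Fintype.ofFinite {x // p x = c}
    have := Fintype.ofFinite {y // q y = c}
    have hc := h c
    rw [Nat.card_eq_fintype_card, Nat.card_eq_fintype_card] at hc
    obtain ⟨g⟩ := Function.Embedding.nonempty_of_card_le hc
    exact ⟨g, g.injective⟩
  choose g hg using key
  refine ⟨fun x => (g (p x) ⟨x, rfl⟩).1, ?_, fun x => (g (p x) ⟨x, rfl⟩).2⟩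
  have aux : ∀ (c d : γ) (u : {x // p x = c}) (v : {x // p x = d}),
      (g c u).1 = (g d v).1 → u.1 = v.1 := by
    intro c d u v huv
    have hcd : c = d := by rw [← (g c u).2, ← (g d v).2, huv]
    subst hcd
    exact congrArg Subtype.val (hg c (Subtype.ext huv))
  intro x y hxy
  exact aux _ _ _ _ hxy

theorem exists_equiv_of_card_fiber_eq {α β γ : Type*} [Finite α] [Finite β]
    (p : α → γ) (q : β → γ) (h : ∀ c, Nat.card {x // p x = c} = Nat.card {y // q y = c}) :
    ∃ e : α ≃ β, ∀ x, q (e x) = p x := by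
  have key : ∀ c, Nonempty ({x // p x = c} ≃ {y // q y = c}) := fun c =>
    Finite.card_eq.1 (h c)
  exact ⟨Equiv.ofFiberEquiv fun c => (key c).some, fun x => Equiv.ofFiberEquiv_map _ x⟩

theorem Multiset.natCard_fiber {α : Type*} [DecidableEq α] (B : Multiset α) (a : α) :
    Nat.card {p : B // p.1 = a} = B.count a := by
  rw [← Nat.card_fin (B.count a)]
  refine Nat.card_congr ⟨fun p => Fin.cast (by rw [p.2]) p.1.2, fun i => ⟨⟨a, i⟩, rfl⟩, ?_, ?_⟩
  · rintro ⟨⟨b, i⟩, rfl⟩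
    rfl
  · intro i
    rfl

theorem Nat.card_sigma_fin_fiber {κ γ : Type*} [Fintype κ] [DecidableEq γ]
    (m : κ → ℕ) (p : κ → γ) (c : γ) :
    Nat.card {i : Σ k, Fin (m k) // p i.1 = c} = ∑ k with p k = c, m k := by
  have e : {i : Σ k, Fin (m k) // p i.1 = c} ≃ Σ k : {k // p k = c}, Fin (m k) :=
    ⟨fun i => ⟨⟨i.1.1, i.2⟩, i.1.2⟩, fun i => ⟨⟨i.1.1, i.2⟩, i.1.2⟩, fun _ => rfl, fun _ => rfl⟩
  rw [Nat.card_congr e, Nat.card_eq_fintype_card, Fintype.card_sigma]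
  simp only [Fintype.card_fin]
  exact (Finset.sum_subtype _ (by simp) _).symm

/-- A matrix of natural numbers whose row sums are the multiplicities of `B` and whose column sums
are bounded by the multiplicities of `B'` induces an injection `Rep B → Rep B'`. -/
theorem exists_injective_isInducedBy {B B' : Multiset ℝ≥0} (M : ℝ≥0 → ℝ≥0 → ℕ)
    (hB : ∀ a ∈ B, 0 < a) (hB' : ∀ b ∈ B', 0 < b)
    (hrow : ∀ (T : Finset ℝ≥0), (∀ b ∈ T, 0 < b) → B'.toFinset ⊆ T → ∀ a, 0 < a →
      ∑ b ∈ T, M a b = B.count a)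
    (hcol : ∀ (T : Finset ℝ≥0), (∀ a ∈ T, 0 < a) → B.toFinset ⊆ T → ∀ b, 0 < b →
      ∑ a ∈ T, M a b ≤ B'.count b) :
    ∃ σ : B → B', Function.Injective σ ∧ IsInducedBy σ M := by
  have hT : ∀ a ∈ B.toFinset, 0 < a := fun a ha => hB a (Multiset.mem_toFinset.1 ha)
  have hT' : ∀ a ∈ B'.toFinset, 0 < a := fun a ha => hB' a (Multiset.mem_toFinset.1 ha)
  have zero_of_notMem : ∀ a b, 0 < a → 0 < b → a ∉ B.toFinset → M a b = 0 := by
    intro a b ha hb hab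
    -- Enlarging the index set by `b` makes `M a b` a summand of a sum that is zero.
    have h := hrow (insert b B'.toFinset) (by simpa [hb] using hT') (Finset.subset_insert _ _) a ha
    rw [Multiset.count_eq_zero.2 (fun h => hab (Multiset.mem_toFinset.2 h)),
      Finset.sum_eq_zero_iff] at h
    exact h b (Finset.mem_insert_self _ _)
  have zero_of_notMem' : ∀ a b, 0 < a → 0 < b → b ∉ B'.toFinset → M a b = 0 := by
    intro a b ha hb hab
    have h := hcol (insert a B.toFinset) (by simpa [ha] using hT) (Finset.subset_insert _ _) b hb
    rw [Multiset.count_eq_zero.2 (fun h => hab (Multiset.mem_toFinset.2 h)),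
      Nat.le_zero, Finset.sum_eq_zero_iff] at h
    exact h a (Finset.mem_insert_self _ _)
  let m : B.toFinset × B'.toFinset → ℕ := fun k => M k.1 k.2
  -- The set with `M a b` points in cell `(a, b)` mediates: row sums match it bijectively with `Rep
  -- B`, column bounds embed it into `Rep B'`.
  obtain ⟨e, he⟩ := exists_equiv_of_card_fiber_eq (fun p : B => p.1)
    (fun i : Σ k, Fin (m k) => (i.1.1 : ℝ≥0)) (by
      intro a
      rw [Multiset.natCard_fiber, Nat.card_sigma_fin_fiber m (fun k => (k.1 : ℝ≥0))]
      by_cases ha : a ∈ B.toFinset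
      · rw [← hrow B'.toFinset hT' subset_rfl a (hT a ha), ← Finset.sum_coe_sort B'.toFinset]
        refine Finset.sum_bij' (fun b _ => (⟨a, ha⟩, b)) (fun k _ => k.2) ?_ ?_ ?_ ?_ ?_
        · simp
        · simp
        · simp
        · rintro ⟨⟨x, hx⟩, y⟩ h
          simp at h
          subst h
          rfl
        · simp [m]
      · rw [Multiset.count_eq_zero.2 (fun h => ha (Multiset.mem_toFinset.2 h)), eq_comm,
          Finset.sum_eq_zero_iff]
        rintro ⟨⟨x, hx⟩, y⟩ h
        simp at h
        subst h
        exact absurd hx ha)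
  obtain ⟨g, hg, hgq⟩ := exists_injective_of_card_fiber_le
    (fun i : Σ k, Fin (m k) => (i.1.2 : ℝ≥0)) (fun p : B' => p.1) (by
      intro b
      rw [Multiset.natCard_fiber, Nat.card_sigma_fin_fiber m (fun k => (k.2 : ℝ≥0))]
      by_cases hb : b ∈ B'.toFinset
      · refine le_of_eq_of_le ?_ (hcol B.toFinset hT subset_rfl b (hT' b hb))
        rw [← Finset.sum_coe_sort B.toFinset]
        symm
        refine Finset.sum_bij' (fun a _ => (a, ⟨b, hb⟩)) (fun k _ => k.1) ?_ ?_ ?_ ?_ ?_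
        · simp
        · simp
        · simp
        · rintro ⟨y, ⟨x, hx⟩⟩ h
          simp at h
          subst h
          rfl
        · simp [m]
      · refine (Finset.sum_eq_zero_iff.2 ?_).le.trans (Nat.zero_le _)
        rintro ⟨y, ⟨x, hx⟩⟩ h
        simp at h
        subst h
        exact absurd hx hb)
  refine ⟨g ∘ e, hg.comp e.injective, fun a b ha hb => ?_⟩
  have e' : {p : B // p.1 = a ∧ ((g ∘ e) p).1 = b} ≃
      {i : Σ k, Fin (m k) // ((i.1.1 : ℝ≥0), (i.1.2 : ℝ≥0)) = (a, b)} :=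
    e.subtypeEquiv fun p => by
      have h1 := hgq (e p)
      have h2 := he p
      rw [Prod.mk.injEq]
      exact and_congr (by rw [← h2]) (by rw [← h1]; rfl)
  rw [Nat.card_congr e',
    Nat.card_sigma_fin_fiber m (fun k => ((k.1 : ℝ≥0), (k.2 : ℝ≥0)))]
  by_cases hab : a ∈ B.toFinset ∧ b ∈ B'.toFinset
  · rw [Finset.sum_eq_single (⟨a, hab.1⟩, ⟨b, hab.2⟩)]
    · rintro ⟨⟨x, hx⟩, ⟨y, hy⟩⟩ h hne
      simp at h hne
      exact absurd h.2 (hne h.1)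
    · simp
  · have h0 : M a b = 0 := by
      by_cases h : a ∈ B.toFinset
      · exact zero_of_notMem' a b ha hb fun h' => hab ⟨h, h'⟩
      · exact zero_of_notMem a b ha hb h
    rw [h0, Finset.sum_eq_zero_iff]
    rintro ⟨⟨x, hx⟩, ⟨y, hy⟩⟩ h
    simp at h
    obtain ⟨rfl, rfl⟩ := h
    exact absurd ⟨hx, hy⟩ hab

/-! ### Telescoping sums and dimension formulas -/

/-- Telescoping over a finite set of positive values that contains all jumps of `p` up to `c`, where
`m` is the left limit of `p`. -/
theorem sum_jumps_eq (p m : ℝ≥0 → ℤ) (T : Finset ℝ≥0) : ∀ c : ℝ≥0, (∀ b ∈ T, 0 < b) →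
    (∀ b ∈ T, b ≤ c) →
    (∀ r s, r < s → s ≤ c → (∀ b ∈ T, r < b → ¬ b < s) → m s = p r) →
    (∀ r s, r ≤ s → s ≤ c → (∀ b ∈ T, r < b → ¬ b ≤ s) → p s = p r) →
    ∑ b ∈ T, (p b - m b) = p c - p 0 := by
  induction T using Finset.induction_on_max with
  | empty =>
    intro c _ _ _ h
    rw [Finset.sum_empty, h 0 c (zero_le) le_rfl (by simp), sub_self]
  | insert a T hlt ih =>
    intro c hpos hc hm hp
    have haT : a ∉ T := fun h => lt_irrefl _ (hlt a h)
    have ha : 0 < a := hpos a (Finset.mem_insert_self _ _)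
    have hac : a ≤ c := hc a (Finset.mem_insert_self _ _)
    -- The induction hypothesis is applied with cutoff `T.sup id`, the last jump before `a` (or `0`
    -- if there is none).
    have hr : T.sup id < a := (Finset.sup_lt_iff ha).2 hlt
    have hle : ∀ b ∈ T, b ≤ T.sup id := fun b hb => Finset.le_sup (f := id) hb
    rw [Finset.sum_insert haT, ih (T.sup id) (fun b hb => hpos b (Finset.mem_insert_of_mem hb)) hle,
      hm (T.sup id) a hr hac, hp a c hac le_rfl]
    · ring
    · intro b hb hab
      rcases Finset.mem_insert.1 hb with rfl | hb
      · exact absurd hab (lt_irrefl _)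
      · exact absurd (hlt b hb) hab.not_gt
    · intro b hb hrb
      rcases Finset.mem_insert.1 hb with rfl | hb
      · exact lt_irrefl _
      · exact absurd (hle b hb) hrb.not_ge
    · intro r s hrs hs h
      refine hm r s hrs (hs.trans (hr.le.trans hac)) fun b hb hrb => ?_
      rcases Finset.mem_insert.1 hb with rfl | hb
      · exact (hs.trans hr.le).not_gt
      · exact h b hb hrb
    · intro r s hrs hs h
      refine hp r s hrs (hs.trans (hr.le.trans hac)) fun b hb hrb => ?_
      rcases Finset.mem_insert.1 hb with rfl | hb
      · exact (hs.trans_lt hr).not_ge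
      · exact h b hb hrb

/-- The two summands of the denominator meet in `A' ⊓ C'`, so the dimension formula turns the
quotient into a second difference. -/
theorem finrank_inf_quotient {K V : Type*} [Field K] [AddCommGroup V] [Module K V]
    [FiniteDimensional K V] {A A' C C' : Submodule K V} (hA : A' ≤ A) (hC : C' ≤ C) :
    (Module.finrank K (↥(A ⊓ C) ⧸ (A' ⊓ C ⊔ A ⊓ C').submoduleOf (A ⊓ C)) : ℤ) =
      ((Module.finrank K ↥(A ⊓ C) : ℤ) - Module.finrank K ↥(A' ⊓ C)) -
        (Module.finrank K ↥(A ⊓ C') - Module.finrank K ↥(A' ⊓ C')) := by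
  have hle : A' ⊓ C ⊔ A ⊓ C' ≤ A ⊓ C :=
    sup_le (inf_le_inf_right _ hA) (inf_le_inf_left _ hC)
  have h1 := Submodule.finrank_quotient_add_finrank ((A' ⊓ C ⊔ A ⊓ C').submoduleOf (A ⊓ C))
  rw [(Submodule.submoduleOfEquivOfLe hle).finrank_eq] at h1
  have h2 := Submodule.finrank_sup_add_finrank_inf_eq (A' ⊓ C) (A ⊓ C')
  have h3 : (A' ⊓ C) ⊓ (A ⊓ C') = A' ⊓ C' := by
    rw [inf_inf_inf_comm, inf_eq_left.2 hA, inf_eq_right.2 hC]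
  rw [h3] at h2
  omega

/-- The quotient of `A ⊓ C` by `A ⊓ C'` embeds into `C / C'`. -/
theorem finrank_inf_sub_le {K V : Type*} [Field K] [AddCommGroup V] [Module K V]
    [FiniteDimensional K V] (A : Submodule K V) {C C' : Submodule K V} (hC : C' ≤ C) :
    (Module.finrank K ↥(A ⊓ C) : ℤ) - Module.finrank K ↥(A ⊓ C') ≤
      Module.finrank K C - Module.finrank K C' := by
  have h2 := Submodule.finrank_sup_add_finrank_inf_eq (A ⊓ C) C'
  rw [inf_assoc, inf_eq_right.2 hC] at h2
  have h3 := Submodule.finrank_mono (sup_le inf_le_right hC : A ⊓ C ⊔ C' ≤ C)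
  omega

/-! ### Bases adapted to a filtration -/

/-- A monotone family of subspaces, restricted to finitely many indices, has an adapted linearly
independent set. -/
theorem exists_linearIndepOn_adapted {K V ι : Type*} [Field K] [AddCommGroup V] [Module K V]
    [LinearOrder ι] {F : ι → Submodule K V} (hF : Monotone F) (T : Finset ι) :
    ∃ S : Set V, LinearIndepOn K id S ∧ ∀ r ∈ T, Submodule.span K (S ∩ F r) = F r := by
  induction T using Finset.induction_on_max with
  | empty => exact ⟨∅, linearIndepOn_empty _ _, by simp⟩
  | insert a T hlt ih =>
    obtain ⟨S, hS, hST⟩ := ih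
    -- Vectors outside `F a` are discarded; the earlier spans survive, since those steps lie in `F
    -- a`.
    obtain ⟨S', h1, h2, h3, h4⟩ := exists_linearIndepOn_id_extension
      (hS.mono (Set.inter_subset_left : S ∩ F a ⊆ S)) (Set.inter_subset_right : S ∩ F a ⊆ F a)
    refine ⟨S', h4, fun r hr => ?_⟩
    refine le_antisymm (Submodule.span_le.2 Set.inter_subset_right) ?_
    rcases Finset.mem_insert.1 hr with rfl | hr
    · rwa [Set.inter_eq_left.2 h1]
    · refine (hST r hr).ge.trans (Submodule.span_mono fun x hx => ?_)
      exact ⟨h2 ⟨hx.1, hF (hlt r hr).le hx.2⟩, hx.2⟩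

/-- A monotone family with finitely many members has an adapted basis. -/
theorem exists_basis_adapted {K V ι : Type*} [Field K] [AddCommGroup V] [Module K V]
    [LinearOrder ι] {F : ι → Submodule K V} (hF : Monotone F) (hfin : (Set.range F).Finite) :
    ∃ (S : Set V) (b : Module.Basis S K V), (∀ v, b v = v) ∧
      ∀ r, Submodule.span K (S ∩ F r) = F r := by
  classical
  have := hfin.fintype
  let T : Finset ι := Finset.univ.image (Set.rangeSplitting F)
  have hT : ∀ r, ∃ t ∈ T, F t = F r := fun r =>
    ⟨_, Finset.mem_image_of_mem _ (Finset.mem_univ ⟨F r, r, rfl⟩), Set.apply_rangeSplitting F _⟩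
  obtain ⟨S, hS, hST⟩ := exists_linearIndepOn_adapted hF T
  obtain ⟨S', h1, h2, h3, h4⟩ := exists_linearIndepOn_id_extension hS (Set.subset_univ S)
  refine ⟨S', Module.Basis.mk (v := ((↑) : S' → V)) h4 ?_,
    fun v => Module.Basis.mk_apply _ _ v, fun r => ?_⟩
  · rw [Subtype.range_coe]
    exact fun x _ => h3 (Set.mem_univ x)
  · obtain ⟨t, ht, htr⟩ := hT r
    refine le_antisymm (Submodule.span_le.2 Set.inter_subset_right) ?_
    rw [← htr]
    refine (hST t ht).ge.trans (Submodule.span_mono fun x hx => ?_)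
    exact ⟨h2 hx.1, hx.2⟩

theorem LinearMap.exists_equiv_of_ker_eq {K V A B : Type*} [Ring K] [AddCommGroup V]
    [AddCommGroup A] [AddCommGroup B] [Module K V] [Module K A] [Module K B]
    (φ : V →ₗ[K] A) (ψ : V →ₗ[K] B) (hφ : Function.Surjective φ) (hψ : Function.Surjective ψ)
    (h : LinearMap.ker φ = LinearMap.ker ψ) : ∃ E : A ≃ₗ[K] B, ∀ x, E (φ x) = ψ x := by
  refine ⟨(φ.quotKerEquivOfSurjective hφ).symm.trans
    ((Submodule.quotEquivOfEq _ _ h).trans (ψ.quotKerEquivOfSurjective hψ)), fun x => ?_⟩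
  rw [LinearEquiv.trans_apply, LinearMap.quotKerEquivOfSurjective_symm_apply,
    LinearEquiv.trans_apply, Submodule.quotEquivOfEq_mk,
    LinearMap.quotKerEquivOfSurjective_apply_mk]

/-! ### Coordinates with death times, and barcodes -/

namespace PersistenceModule

/-- Linear coordinates `e` on the space in degree `0` are compatible with the death times `d` if
the elements that die at a value `≤ r` are those supported on the coordinates with `d i ≤ r`. -/
def IsCoordinates (U : PersistenceModule) {ι : Type*} (d : ι → ℝ≥0∞)
    (e : U.obj 0 ≃ₗ[ZMod 2] (ι → ZMod 2)) : Prop :=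
  ∀ (r : ℝ≥0) (x : U.obj 0), x ∈ U.kerPlus r ↔ ∀ i, (r : ℝ≥0∞) < d i → e x i = 0

/-- The generators of a direct sum of interval modules, in degree `r`. -/
noncomputable def directSumIntervalOfFun {ι : Type*} [Fintype ι] (d : ι → ℝ≥0∞) (r : ℝ≥0) :
    (ι → ZMod 2) →ₗ[ZMod 2] (directSum fun i => interval (d i)).obj r :=
  (DirectSum.linearEquivFunOnFintype (ZMod 2) ι
    fun i => (interval (d i)).obj r).symm.toLinearMap ∘ₗ
    LinearMap.pi fun i => LinearMap.pi (φ := fun _ : PLift ((r : ℝ≥0∞) < d i) => ZMod 2)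
      fun _ => LinearMap.proj i

theorem directSumIntervalOfFun_apply {ι : Type*} [Fintype ι] (d : ι → ℝ≥0∞) (r : ℝ≥0)
    (x : ι → ZMod 2) (i : ι) (p : PLift ((r : ℝ≥0∞) < d i)) :
    (show ⨁ i, (interval (d i)).obj r from directSumIntervalOfFun d r x) i p = x i := by
  rfl

theorem directSumIntervalOfFun_surjective {ι : Type*} [Fintype ι] (d : ι → ℝ≥0∞) (r : ℝ≥0) :
    Function.Surjective (directSumIntervalOfFun d r) := by
  classical
  intro y
  refine ⟨fun i => if h : (r : ℝ≥0∞) < d i then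
    (show ⨁ i, (interval (d i)).obj r from y) i ⟨h⟩ else 0, ?_⟩
  refine DFinsupp.ext fun i => funext fun p => ?_
  refine (directSumIntervalOfFun_apply d r _ i p).trans ?_
  rw [dif_pos p.down]

theorem directSumIntervalOfFun_eq_zero_iff {ι : Type*} [Fintype ι] (d : ι → ℝ≥0∞) (r : ℝ≥0)
    (x : ι → ZMod 2) :
    directSumIntervalOfFun d r x = 0 ↔ ∀ i, (r : ℝ≥0∞) < d i → x i = 0 := by
  constructor
  · intro h i hi
    rw [← directSumIntervalOfFun_apply d r x i ⟨hi⟩, h]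
    rfl
  · intro h
    refine DFinsupp.ext fun i => funext fun p => ?_
    exact (directSumIntervalOfFun_apply d r _ i p).trans (h i p.down)

theorem map_directSumIntervalOfFun {ι : Type*} [Fintype ι] (d : ι → ℝ≥0∞) {r s : ℝ≥0}
    (h : r ≤ s) (x : ι → ZMod 2) :
    (directSum fun i => interval (d i)).map h (directSumIntervalOfFun d r x) =
      directSumIntervalOfFun d s x := by
  refine DFinsupp.ext fun i => funext fun p => ?_
  rfl

/-- Surjectivity makes degree `r` the quotient of degree `0` by `ker⁺_r`, so the kernel filtration
determines the module, and naturality can be checked on elements coming from degree `0`. -/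
theorem IsCoordinates.isIsomorphic {U : PersistenceModule} {ι : Type*} [Fintype ι]
    {d : ι → ℝ≥0∞} {e : U.obj 0 ≃ₗ[ZMod 2] (ι → ZMod 2)} (he : U.IsCoordinates d e)
    (hU : ∀ r : ℝ≥0, Function.Surjective (U.map (zero_le : 0 ≤ r))) :
    U.IsIsomorphic (directSum fun i => interval (d i)) := by
  have key : ∀ r : ℝ≥0, ∃ E : U.obj r ≃ₗ[ZMod 2] (directSum fun i => interval (d i)).obj r,
      ∀ x, E (U.map (zero_le : 0 ≤ r) x) = (directSumIntervalOfFun d r ∘ₗ e.toLinearMap) x := by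
    intro r
    refine LinearMap.exists_equiv_of_ker_eq _ _ (hU r)
      ((directSumIntervalOfFun_surjective d r).comp e.surjective) ?_
    ext x
    exact (he r x).trans (directSumIntervalOfFun_eq_zero_iff d r (e x)).symm
  choose E hE using key
  refine ⟨E, fun {s t} h x => ?_⟩
  obtain ⟨x, rfl⟩ := hU s x
  rw [hE, ← LinearMap.comp_apply, U.map_comp, hE]
  exact (map_directSumIntervalOfFun d h (e x)).symm

theorem IsIsomorphic.exists_isCoordinates {U : PersistenceModule} {ι : Type*} [Fintype ι]
    {d : ι → ℝ≥0∞} (hd : ∀ i, 0 < d i)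
    (hU : U.IsIsomorphic (directSum fun i => interval (d i))) :
    ∃ e : U.obj 0 ≃ₗ[ZMod 2] (ι → ZMod 2), U.IsCoordinates d e := by
  obtain ⟨E, hE⟩ := hU
  have hinj : Function.Injective (directSumIntervalOfFun d 0) := by
    rw [← LinearMap.ker_eq_bot, LinearMap.ker_eq_bot']
    intro x hx
    rw [directSumIntervalOfFun_eq_zero_iff] at hx
    exact funext fun i => hx i (hd i)
  let F := LinearEquiv.ofBijective (directSumIntervalOfFun d 0)
    ⟨hinj, directSumIntervalOfFun_surjective d 0⟩
  refine ⟨(E 0).trans F.symm, fun r x => ?_⟩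
  obtain ⟨y, rfl⟩ := ((E 0).trans F.symm).symm.surjective x
  rw [LinearEquiv.apply_symm_apply, ← directSumIntervalOfFun_eq_zero_iff,
    ← map_directSumIntervalOfFun d (zero_le : 0 ≤ r), kerPlus, LinearMap.mem_ker,
    ← (E r).map_eq_zero_iff, hE]
  have : E 0 (((E 0).trans F.symm).symm y) = directSumIntervalOfFun d 0 y := by
    rw [LinearEquiv.trans_symm, LinearEquiv.trans_apply, LinearEquiv.apply_symm_apply]
    rfl
  rw [this]

theorem IsBarcode.exists_isCoordinates {U : PersistenceModule} {B : Multiset ℝ≥0}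
    (hB : U.IsBarcode B) :
    ∃ (ι : Type) (_ : Fintype ι) (d : ι → ℝ≥0∞) (e : U.obj 0 ≃ₗ[ZMod 2] (ι → ZMod 2)),
      U.IsCoordinates d e ∧ ∀ b : ℝ≥0, Nat.card {i // d i = b} = B.count b := by
  obtain ⟨hpos, k, hU⟩ := hB
  let d : B ⊕ Fin k → ℝ≥0∞ := Sum.elim (fun p => (p.1 : ℝ≥0∞)) fun _ => ⊤
  have hd : Sum.elim (fun p : B => interval (p.1 : ℝ≥0∞)) (fun _ : Fin k => interval ⊤) =
      fun i => interval (d i) := by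
    funext i
    cases i <;> rfl
  rw [hd] at hU
  obtain ⟨e, he⟩ := hU.exists_isCoordinates (d := d) (by
    rintro (p | p)
    · exact ENNReal.coe_pos.2 (hpos _ Multiset.coe_mem)
    · exact ENNReal.zero_lt_top)
  refine ⟨_, inferInstance, d, e, he, fun b => ?_⟩
  rw [← Multiset.natCard_fiber]
  refine Nat.card_congr ⟨fun i => ?_, fun p => ⟨Sum.inl p.1, ?_⟩, ?_, ?_⟩
  · rcases i with ⟨p | p, h⟩
    · exact ⟨p, ENNReal.coe_injective h⟩
    · exact absurd h ENNReal.top_ne_coe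
  · exact congrArg _ p.2
  · rintro ⟨p | p, h⟩
    · rfl
    · exact absurd h ENNReal.top_ne_coe
  · intro p
    rfl

/-- Finite death times form the multiset; coordinates with `d i = ⊤` give the copies of `κ_∞`. -/
theorem IsCoordinates.exists_isBarcode {U : PersistenceModule} {ι : Type*} [Fintype ι]
    {d : ι → ℝ≥0∞} {e : U.obj 0 ≃ₗ[ZMod 2] (ι → ZMod 2)} (he : U.IsCoordinates d e)
    (hd : ∀ i, 0 < d i) (hU : ∀ r : ℝ≥0, Function.Surjective (U.map (zero_le : 0 ≤ r))) :
    ∃ B, U.IsBarcode B := by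
  classical
  let f : {i // d i ≠ ⊤} → ℝ≥0 := fun i => (d i).toNNReal
  have hf : ∀ i, (f i : ℝ≥0∞) = d i := fun i => ENNReal.coe_toNNReal i.2
  let B : Multiset ℝ≥0 := Finset.univ.val.map f
  obtain ⟨g, hg⟩ := exists_equiv_of_card_fiber_eq (fun p : B => p.1) f (by
    intro c
    rw [Multiset.natCard_fiber, Multiset.count_map, Nat.card_eq_fintype_card,
      Fintype.card_subtype]
    simp only [eq_comm]
    rfl)
  let g' : B ⊕ Fin (Fintype.card {i // ¬ d i ≠ ⊤}) ≃ ι :=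
    (Equiv.sumCongr g (Fintype.equivFin _).symm).trans (Equiv.sumCompl _)
  refine ⟨B, fun b hb => ?_, Fintype.card {i // ¬ d i ≠ ⊤}, ?_⟩
  · obtain ⟨i, -, rfl⟩ := Multiset.mem_map.1 hb
    rw [← ENNReal.coe_pos, hf]
    exact hd _
  have hd' : Sum.elim (fun p : B => interval (p.1 : ℝ≥0∞))
      (fun _ : Fin (Fintype.card {i // ¬ d i ≠ ⊤}) => interval ⊤) =
      fun j => interval (d (g' j)) := by
    funext j
    rcases j with p | p
    · have : (p.1 : ℝ≥0∞) = d (g' (Sum.inl p)) := by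
        rw [← hg p, hf]
        rfl
      rw [← this]
      rfl
    · have : d (g' (Sum.inr p)) = ⊤ := not_not.1 ((Fintype.equivFin _).symm p).2
      rw [this]
      rfl
  rw [hd']
  refine IsCoordinates.isIsomorphic
    (e := e.trans (LinearEquiv.funCongrLeft (ZMod 2) (ZMod 2) g')) (fun r x => ?_) hU
  rw [he]
  exact (g'.forall_congr_right (q := fun i => (r : ℝ≥0∞) < d i → e x i = 0)).symm

/-! ### Dimensions and jumps of the kernel filtration -/

theorem finrank_comap_iInf_ker_proj {V ι : Type*} [AddCommGroup V] [Module (ZMod 2) V] [Fintype ι]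
    (e : V ≃ₗ[ZMod 2] (ι → ZMod 2)) (p : ι → Prop) (W : Submodule (ZMod 2) V)
    (hW : ∀ x, x ∈ W ↔ ∀ i, p i → e x i = 0) :
    Module.finrank (ZMod 2) W = Nat.card {i // ¬ p i} := by
  classical
  have h1 : W.map e.toLinearMap =
      ⨅ i ∈ {i | p i}, LinearMap.ker (LinearMap.proj i : (ι → ZMod 2) →ₗ[ZMod 2] ZMod 2) := by
    ext y
    obtain ⟨x, rfl⟩ := e.surjective y
    simp [hW, Submodule.mem_iInf]
  have h2 := (LinearMap.iInfKerProjEquiv (ZMod 2) (fun _ : ι => ZMod 2) (I := {i | ¬ p i})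
    (J := {i | p i}) (Set.disjoint_left.2 fun _ h h' => h h')
    (fun i _ => (em (p i)).symm)).finrank_eq
  rw [← h1] at h2
  refine (LinearEquiv.finrank_map_eq e W).symm.trans (h2.trans ?_)
  rw [Module.finrank_fintype_fun_eq_card, Nat.card_eq_fintype_card]
  rfl

theorem kerPlus_mono (U : PersistenceModule) : Monotone U.kerPlus := by
  intro r s h x hx
  rw [kerPlus, LinearMap.mem_ker] at hx ⊢
  rw [← U.map_comp (zero_le : 0 ≤ r) h, LinearMap.comp_apply, hx, map_zero]

theorem kerPlus_zero (U : PersistenceModule) : U.kerPlus 0 = ⊥ := by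
  rw [kerPlus, U.map_id, LinearMap.ker_id]

theorem kerMinus_le_kerPlus (U : PersistenceModule) (b : ℝ≥0) : U.kerMinus b ≤ U.kerPlus b :=
  iSup_le fun r => U.kerPlus_mono r.2.le

theorem mem_kerMinus' (U : PersistenceModule) {b : ℝ≥0} (hb : 0 < b) (x : U.obj 0) :
    x ∈ U.kerMinus b ↔ ∃ r < b, x ∈ U.kerPlus r :=
  U.mem_kerMinus hb x

theorem IsCoordinates.mem_kerMinus {U : PersistenceModule} {ι : Type*} [Fintype ι]
    {d : ι → ℝ≥0∞} {e : U.obj 0 ≃ₗ[ZMod 2] (ι → ZMod 2)} (he : U.IsCoordinates d e)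
    {b : ℝ≥0} (hb : 0 < b) (x : U.obj 0) :
    x ∈ U.kerMinus b ↔ ∀ i, (b : ℝ≥0∞) ≤ d i → e x i = 0 := by
  classical
  rw [U.mem_kerMinus' hb]
  constructor
  · rintro ⟨r, hr, hx⟩ i hi
    exact (he r x).1 hx i ((ENNReal.coe_lt_coe.2 hr).trans_le hi)
  · intro h
    -- The witness is the largest death time below `b`, or `0` if there is none, which is where `0 <
    -- b` enters.
    refine ⟨(Finset.univ.filter fun i => d i < b).sup fun i => (d i).toNNReal, ?_, ?_⟩
    · refine (Finset.sup_lt_iff hb).2 fun i hi => ?_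
      have hi := (Finset.mem_filter.1 hi).2
      rwa [← ENNReal.coe_lt_coe, ENNReal.coe_toNNReal hi.ne_top]
    · refine (he _ x).2 fun i hi => h i (le_of_not_gt fun hlt => hi.not_ge ?_)
      rw [← ENNReal.coe_toNNReal hlt.ne_top, ENNReal.coe_le_coe]
      exact Finset.le_sup (f := fun i => (d i).toNNReal)
        (Finset.mem_filter.2 ⟨Finset.mem_univ _, hlt⟩)

theorem IsBarcode.finiteDimensional {U : PersistenceModule} {B : Multiset ℝ≥0}
    (hB : U.IsBarcode B) : FiniteDimensional (ZMod 2) (U.obj 0) := by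
  obtain ⟨ι, _, d, e, -, -⟩ := hB.exists_isCoordinates
  exact e.symm.finiteDimensional

/-- The dimensions count the coordinates with `d i ≤ b` and with `d i < b`; the difference is the
number with `d i = b`. -/
theorem IsBarcode.finrank_kerPlus {U : PersistenceModule} {B : Multiset ℝ≥0}
    (hB : U.IsBarcode B) {b : ℝ≥0} (hb : 0 < b) :
    Module.finrank (ZMod 2) (U.kerPlus b) =
      B.count b + Module.finrank (ZMod 2) (U.kerMinus b) := by
  classical
  obtain ⟨ι, _, d, e, he, hcard⟩ := hB.exists_isCoordinates
  rw [finrank_comap_iInf_ker_proj e _ _ (he b),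
    finrank_comap_iInf_ker_proj e _ _ (he.mem_kerMinus hb), ← hcard]
  simp only [not_lt, not_le]
  simp only [le_iff_eq_or_lt, Nat.card_eq_fintype_card]
  exact Fintype.card_subtype_or_disjoint (fun i => d i = b) (fun i => d i < b) (by
    rw [Pi.disjoint_iff]
    intro i
    rw [Prop.disjoint_iff]
    exact fun h => h.2.ne h.1)

theorem IsBarcode.kerPlus_eq {U : PersistenceModule} {B : Multiset ℝ≥0} (hB : U.IsBarcode B)
    {r s : ℝ≥0} (hrs : r ≤ s) (h : ∀ b ∈ B, r < b → ¬ b ≤ s) : U.kerPlus s = U.kerPlus r := by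
  obtain ⟨ι, _, d, e, he, hcard⟩ := hB.exists_isCoordinates
  refine le_antisymm (fun x hx => ?_) (U.kerPlus_mono hrs)
  rw [he] at hx ⊢
  intro i hi
  refine hx i (lt_of_not_ge fun hle => ?_)
  have htop : d i ≠ ⊤ := (hle.trans_lt ENNReal.coe_lt_top).ne
  rw [← ENNReal.coe_toNNReal htop, ENNReal.coe_lt_coe] at hi
  rw [← ENNReal.coe_toNNReal htop, ENNReal.coe_le_coe] at hle
  refine h _ (Multiset.count_pos.1 ?_) hi hle
  rw [← hcard]
  have : Nonempty {j // d j = (d i).toNNReal} := ⟨⟨i, (ENNReal.coe_toNNReal htop).symm⟩⟩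
  exact Nat.card_pos

theorem IsBarcode.kerMinus_eq {U : PersistenceModule} {B : Multiset ℝ≥0} (hB : U.IsBarcode B)
    {r s : ℝ≥0} (hrs : r < s) (h : ∀ b ∈ B, r < b → ¬ b < s) : U.kerMinus s = U.kerPlus r := by
  refine le_antisymm (fun x hx => ?_)
    (fun x hx => (U.mem_kerMinus' (zero_le.trans_lt hrs) x).2 ⟨r, hrs, hx⟩)
  obtain ⟨t, ht, hx⟩ := (U.mem_kerMinus' (zero_le.trans_lt hrs) x).1 hx
  rw [← hB.kerPlus_eq (le_max_left r t) fun b hb hrb hbt =>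
    h b hb hrb (hbt.trans_lt (max_lt hrs ht))]
  exact U.kerPlus_mono (le_max_right r t) hx

/-- The sum over the values in `T` of the jumps of a function of the filtration by kernels. -/
theorem IsBarcode.sum_jumps {U : PersistenceModule} {B : Multiset ℝ≥0} (hB : U.IsBarcode B)
    (φ : Submodule (ZMod 2) (U.obj 0) → ℤ) {T : Finset ℝ≥0} (hT : ∀ b ∈ T, 0 < b)
    (hBT : B.toFinset ⊆ T) {c : ℝ≥0} (hc : ∀ b ∈ T, b ≤ c) :
    ∑ b ∈ T, (φ (U.kerPlus b) - φ (U.kerMinus b)) = φ (U.kerPlus c) - φ ⊥ := by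
  have hBT' : ∀ b ∈ B, b ∈ T := fun b hb => hBT (Multiset.mem_toFinset.2 hb)
  rw [sum_jumps_eq (fun b => φ (U.kerPlus b)) (fun b => φ (U.kerMinus b)) T c hT hc
    (fun r s hrs _ h => congrArg φ (hB.kerMinus_eq hrs fun b hb => h b (hBT' b hb)))
    (fun r s hrs _ h => congrArg φ (hB.kerPlus_eq hrs fun b hb => h b (hBT' b hb))),
    kerPlus_zero]

end PersistenceModule

/-! ### Zero-dimensional homology of Vietoris–Rips graphs -/

theorem graphH0Map_ofLE_injective {Z : Type*} {G H : SimpleGraph Z} (h : G = H) (hle : G ≤ H) :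
    Function.Injective (graphH0Map (SimpleGraph.Hom.ofLE hle)) := by
  subst h
  have : SimpleGraph.ConnectedComponent.map (SimpleGraph.Hom.ofLE hle) = id :=
    funext fun C => C.map_id
  rw [graphH0Map, this, Finsupp.lmapDomain_id]
  exact Function.injective_id

theorem graphH0Map_ofLE_surjective {Z : Type*} {G H : SimpleGraph Z} (hle : G ≤ H) :
    Function.Surjective (graphH0Map (SimpleGraph.Hom.ofLE hle)) := by
  refine Finsupp.mapDomain_surjective fun C => ?_
  induction C using SimpleGraph.ConnectedComponent.ind with
  | h v => exact ⟨G.connectedComponentMk v, rfl⟩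

theorem graphH0Map_injective {X Z : Type*} {G : SimpleGraph X} {H : SimpleGraph Z} (φ : G →g H)
    (h : Function.Injective (SimpleGraph.ConnectedComponent.map φ)) :
    Function.Injective (graphH0Map φ) :=
  Finsupp.mapDomain_injective h

/-- The augmentation, which sends the class of every connected component to `1`. -/
noncomputable def graphH0Augmentation {Z : Type*} (G : SimpleGraph Z) :
    graphH0 G →ₗ[ZMod 2] ZMod 2 :=
  Finsupp.linearCombination (ZMod 2) fun _ => 1

theorem graphH0Augmentation_map {X Z : Type*} {G : SimpleGraph X} {H : SimpleGraph Z}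
    (φ : G →g H) (x : graphH0 G) :
    graphH0Augmentation H (graphH0Map φ x) = graphH0Augmentation G x :=
  Finsupp.linearCombination_mapDomain _ _ _

theorem graphH0Augmentation_injective {Z : Type*} {G : SimpleGraph Z} (hG : G.Preconnected) :
    Function.Injective (graphH0Augmentation G) := by
  have := hG.subsingleton_connectedComponent
  rw [← LinearMap.ker_eq_bot, LinearMap.ker_eq_bot']
  intro x hx
  ext C
  have : x = Finsupp.single C (x C) := by
    ext D
    rw [Subsingleton.elim D C, Finsupp.single_eq_same]
  rw [this, graphH0Augmentation, Finsupp.linearCombination_single] at hx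
  simpa using hx

theorem exists_vietorisRips_eq_of_lt (Z : Type*) [MetricSpace Z] [Finite Z] (r : ℝ≥0) :
    ∃ s, r < s ∧ vietorisRips Z r = vietorisRips Z s := by
  obtain ⟨s, hs, h⟩ : ∃ s, r < s ∧ ∀ x y : Z, nndist x y ≤ s → nndist x y ≤ r := by
    have h1 : ∀ᶠ s in nhdsWithin r (Set.Ioi r), ∀ p : Z × Z,
        nndist p.1 p.2 ≤ s → nndist p.1 p.2 ≤ r := by
      rw [Filter.eventually_all]
      intro p
      by_cases hp : nndist p.1 p.2 ≤ r
      · exact Filter.Eventually.of_forall fun _ _ => hp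
      · filter_upwards [nhdsWithin_le_nhds (Iio_mem_nhds (lt_of_not_ge hp))] with s hs h
        exact absurd h hs.not_ge
    obtain ⟨s, h, hs⟩ := (h1.and self_mem_nhdsWithin).exists
    exact ⟨s, hs, fun x y => h (x, y)⟩
  refine ⟨s, hs, le_antisymm (vietorisRips_mono Z hs.le) fun x y hxy => ⟨hxy.1, ?_⟩⟩
  exact h x y hxy.2

theorem PH0_map_surjective (Z : Type*) [MetricSpace Z] (r : ℝ≥0) :
    Function.Surjective ((PH0 Z).map (zero_le : 0 ≤ r)) :=
  graphH0Map_ofLE_surjective _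

/-- Right continuity of the filtration: the graph of a finite space is constant just after `r`.
Hence death times are attained and bars are half-open. -/
theorem mem_kerPlus_PH0_of_forall_gt {Z : Type*} [MetricSpace Z] [Finite Z] {r : ℝ≥0}
    {x : (PH0 Z).obj 0} (h : ∀ s, r < s → x ∈ (PH0 Z).kerPlus s) : x ∈ (PH0 Z).kerPlus r := by
  obtain ⟨s, hs, heq⟩ := exists_vietorisRips_eq_of_lt Z r
  have hx := h s hs
  rw [kerPlus, LinearMap.mem_ker, ← (PH0 Z).map_comp (zero_le : 0 ≤ r) hs.le,
    LinearMap.comp_apply] at hx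
  exact graphH0Map_ofLE_injective heq _ (hx.trans (map_zero _).symm)

theorem exists_isBarcode_PH0 (Z : Type*) [MetricSpace Z] [Finite Z] :
    ∃ B, (PH0 Z).IsBarcode B := by
  classical
  -- Over `ℤ/2` the space itself is a finite set, so it has only finitely many subspaces.
  have hfin : Finite (graphH0 (vietorisRips Z 0)) := Finite.of_injective _ DFunLike.coe_injective
  have : Finite ((PH0 Z).obj 0) := hfin
  obtain ⟨S, b, hb, hS⟩ := exists_basis_adapted (PH0 Z).kerPlus_mono (Set.toFinite _)
  have := Fintype.ofFinite S
  let d : S → ℝ≥0∞ := fun v => ⨅ (r : ℝ≥0) (_ : v.1 ∈ (PH0 Z).kerPlus r), (r : ℝ≥0∞)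
  have hd : ∀ (v : S) (r : ℝ≥0), d v ≤ r ↔ v.1 ∈ (PH0 Z).kerPlus r := by
    intro v r
    refine ⟨fun h => mem_kerPlus_PH0_of_forall_gt fun s hs => ?_, fun h => iInf₂_le r h⟩
    have hlt : d v < s := h.trans_lt (ENNReal.coe_lt_coe.2 hs)
    obtain ⟨t, hv, ht⟩ := by simpa only [d, iInf_lt_iff] using hlt
    exact (PH0 Z).kerPlus_mono (ENNReal.coe_lt_coe.1 ht).le hv
  refine IsCoordinates.exists_isBarcode (d := d) (e := b.equivFun) (fun r x => ?_) (fun v => ?_)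
    (PH0_map_surjective Z)
  · have himage : S ∩ (PH0 Z).kerPlus r = b '' {v : S | d v ≤ r} := by
      ext v
      constructor
      · exact fun h => ⟨⟨v, h.1⟩, (hd _ _).2 h.2, hb _⟩
      · rintro ⟨w, hw, rfl⟩
        rw [hb]
        exact ⟨w.2, (hd _ _).1 hw⟩
    rw [← hS r, himage, Module.Basis.mem_span_image]
    simp only [Module.Basis.equivFun_apply]
    constructor
    · intro h v hv
      by_contra hne
      exact (h (Finsupp.mem_support_iff.2 hne)).not_gt hv
    · intro h v hv
      by_contra hlt
      exact Finsupp.mem_support_iff.1 hv (h v (lt_of_not_ge hlt))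
  -- A basis vector with death time `0` would lie in `ker⁺_0 = ⊥`.
  · refine lt_of_not_ge fun hle => b.ne_zero v ?_
    have := (hd v 0).1 (hle.trans_eq ENNReal.coe_zero.symm)
    rw [kerPlus_zero] at this
    rw [hb]
    exact this

theorem isBarcode_barcode_PH0 (Z : Type*) [MetricSpace Z] [Finite Z] :
    (PH0 Z).IsBarcode (PH0 Z).barcode := by
  rw [barcode, dif_pos (exists_isBarcode_PH0 Z)]
  exact (exists_isBarcode_PH0 Z).choose_spec

theorem inducedZero_injective {X Z : Type*} [MetricSpace X] [MetricSpace Z] {f : X → Z}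
    (hf : Function.Injective f) : Function.Injective (inducedZero f) := by
  refine graphH0Map_injective _ fun C D h => ?_
  induction C, D using SimpleGraph.ConnectedComponent.ind₂ with
  | h x y =>
    have hxy : (vietorisRips Z 0).Reachable (f x) (f y) := SimpleGraph.ConnectedComponent.exact h
    have hbot : vietorisRips Z 0 = ⊥ := by
      ext u v
      exact ⟨fun huv => huv.1 (dist_le_zero.1 huv.2), fun huv => huv.elim⟩
    rw [hbot, SimpleGraph.reachable_bot] at hxy
    rw [hf hxy]

/-- Past a bound for the distances of `Z`, the kernel contains the image of every kernel of `X`. -/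
theorem exists_map_kerPlus_le (X : Type*) {Z : Type*} [MetricSpace X] [MetricSpace Z] [Finite Z]
    (f : X → Z) :
    ∃ c₀, ∀ c, c₀ ≤ c → ∀ a, ((PH0 X).kerPlus a).map (inducedZero f) ≤ (PH0 Z).kerPlus c := by
  have := Fintype.ofFinite Z
  refine ⟨Finset.univ.sup fun p : Z × Z => nndist p.1 p.2, fun c hc a => ?_⟩
  rintro _ ⟨x, hx, rfl⟩
  have hconn : (vietorisRips Z c).Preconnected := by
    intro u v
    by_cases huv : u = v
    · rw [huv]
    · refine SimpleGraph.Adj.reachable ⟨huv, ?_⟩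
      exact NNReal.coe_le_coe.2 ((Finset.le_sup (f := fun p : Z × Z => nndist p.1 p.2)
        (Finset.mem_univ (u, v))).trans hc)
  rw [kerPlus, LinearMap.mem_ker]
  refine graphH0Augmentation_injective hconn ?_
  -- Structure maps preserve the augmentation, so a class that dies has augmentation zero.
  have h0 : graphH0Augmentation (vietorisRips X 0) x = 0 :=
    (graphH0Augmentation_map (SimpleGraph.Hom.ofLE (vietorisRips_mono X (zero_le : 0 ≤ a)))
      x).symm.trans ((congrArg _ hx).trans (map_zero _))
  refine Eq.trans ?_ (map_zero (graphH0Augmentation (vietorisRips Z c))).symm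
  exact (graphH0Augmentation_map _ _).trans ((graphH0Augmentation_map _ _).trans h0)

/-! ### Row and column sums of the block function -/

theorem proposition4p4 {X Z : Type*} [MetricSpace X] [Finite X] [MetricSpace Z] [Finite Z]
    (f : X → Z) (hf : Function.Injective f) :
    ∃ σ : (PH0 X).barcode → (PH0 Z).barcode,
      Function.Injective σ ∧ IsInducedBy σ (blockFunction f) := by
  have hX := isBarcode_barcode_PH0 X
  have hZ := isBarcode_barcode_PH0 Z
  have := hX.finiteDimensional
  have := hZ.finiteDimensional
  have hinj := inducedZero_injective hf
  have hcard := fun a b => finrank_inf_quotient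
    (Submodule.map_mono (f := inducedZero f) ((PH0 X).kerMinus_le_kerPlus a))
    ((PH0 Z).kerMinus_le_kerPlus b)
  refine exists_injective_isInducedBy _ hX.1 hZ.1 ?_ ?_
  · intro T hT hBT a ha
    obtain ⟨c, hc⟩ := exists_map_kerPlus_le X f
    -- The cutoff must bound `T` and also be large enough for `ker⁺` of `Z` to contain the image.
    have hc := hc (max c (T.sup id)) (le_max_left _ _)
    have hsum := hZ.sum_jumps (fun C =>
      (Module.finrank (ZMod 2) ↥(((PH0 X).kerPlus a).map (inducedZero f) ⊓ C) : ℤ) -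
        Module.finrank (ZMod 2) ↥(((PH0 X).kerMinus a).map (inducedZero f) ⊓ C)) hT hBT
      (fun b hb => (Finset.le_sup (f := id) hb).trans (le_max_right c (T.sup id)))
    simp only [← hcard] at hsum
    rw [inf_eq_left.2 (hc a), inf_eq_left.2 ((Submodule.map_mono
        ((PH0 X).kerMinus_le_kerPlus a)).trans (hc a)), inf_bot_eq, inf_bot_eq, sub_self, sub_zero,
      ← (Submodule.equivMapOfInjective _ hinj _).finrank_eq,
      ← (Submodule.equivMapOfInjective _ hinj _).finrank_eq] at hsum
    have := hX.finrank_kerPlus ha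
    zify
    refine hsum.trans ?_
    rw [this]
    push_cast
    ring
  · intro T hT hBT b hb
    have hsum := hX.sum_jumps (fun A =>
      (Module.finrank (ZMod 2) ↥(A.map (inducedZero f) ⊓ (PH0 Z).kerPlus b) : ℤ) -
        Module.finrank (ZMod 2) ↥(A.map (inducedZero f) ⊓ (PH0 Z).kerMinus b)) hT hBT
      (fun b hb => Finset.le_sup (f := id) hb)
    have hle := finrank_inf_sub_le (((PH0 X).kerPlus (T.sup id)).map (inducedZero f))
      ((PH0 Z).kerMinus_le_kerPlus b)
    have hcount := hZ.finrank_kerPlus hb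
    rw [Submodule.map_bot, bot_inf_eq, bot_inf_eq, sub_self, sub_zero] at hsum
    -- The second difference is regrouped so that the jumps are taken in `a` rather than in `b`.
    have hM : (∑ a ∈ T, (blockFunction f a b : ℤ)) = _ :=
      (Finset.sum_congr rfl fun a _ => (hcard a b).trans (by ring)).trans hsum
    zify
    rw [hM]
    rw [hcount] at hle
    push_cast at hle
    linarith
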